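/- Let $k$ be an algebraically closed field of characteristic $p>0$, and let $\mathbb G_a$ be the additive group over $k$, with coordinate Hopf algebra $k[\mathbb G_a]=k[T]$, $\Delta(T)=T\otimes 1+1\otimes T$. A rational $\mathbb G_a$-module is a (right) comodule over $k[T]$. Then the category of finite dimensional rational $\mathbb G_a$-modules is wild. That is, with $R=k\langle x,y\rangle$ the free associative $k$-algebra on two generators, there is a rational $\mathbb G_a$-module $M$ together with a right $R$-module structure, compatible with its $k$-vector space structure, for which $R$ acts by endomorphisms of rational $\mathbb G_a$-modules and $M$ is free of finite rank over $R$, such that the functor $N\mapsto M\otimes_R N$ from finite dimensional left $R$-modules to finite dimensional rational $\mathbb G_a$-modules sends indecomposable modules to indecomposable modules and non-isomorphic modules to non-isomorphic modules. -/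

import Mathlib

open CategoryTheory CategoryTheory.Limits
open scoped TensorProduct

universe u

/-! ### The additive group

The group scheme `𝔾_a` over `k` is given by its coordinate Hopf algebra `k[T]`, in which `T` is
primitive. A rational `𝔾_a`-module is a comodule over this Hopf algebra. -/

/-- The coordinate ring `k[𝔾_a] = k[T]` of the additive group over `k`. (A synonym of `k[T]`, so that
its Hopf algebra structure is not confused with any other structure on polynomials.) -/
def GaCoord (k : Type u) [Field k] : Type u := Polynomial k

namespace GaCoord

variable (k : Type u) [Field k]

noncomputable instance : CommRing (GaCoord k) := inferInstanceAs (CommRing (Polynomial k))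

noncomputable instance : Algebra k (GaCoord k) := inferInstanceAs (Algebra k (Polynomial k))

/-- The coordinate function `T` on `𝔾_a`. -/
noncomputable def T : GaCoord k := (Polynomial.X : Polynomial k)

/-- The `k`-algebra homomorphism `k[T] → A` sending `T` to `a`. -/
noncomputable def lift {A : Type*} [Semiring A] [Algebra k A] (a : A) : GaCoord k →ₐ[k] A :=
  (Polynomial.aeval a : Polynomial k →ₐ[k] A)

@[simp] theorem lift_T {A : Type*} [Semiring A] [Algebra k A] (a : A) : lift k a (T k) = a :=
  Polynomial.aeval_X a

variable {k} in
theorem algHom_ext {A : Type*} [Semiring A] [Algebra k A] {f g : GaCoord k →ₐ[k] A}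
    (h : f (T k) = g (T k)) : f = g :=
  Polynomial.algHom_ext (f := f) (g := g) h

/-- The group law of `𝔾_a`: comultiplication `T ↦ T ⊗ 1 + 1 ⊗ T` and counit `T ↦ 0`. -/
noncomputable instance : Bialgebra k (GaCoord k) :=
  Bialgebra.ofAlgHom (lift k (T k ⊗ₜ[k] 1 + 1 ⊗ₜ[k] T k)) (lift k 0)
    (algHom_ext (by
      simp [Algebra.TensorProduct.one_def, TensorProduct.add_tmul, TensorProduct.tmul_add]
      abel))
    (algHom_ext (by simp))
    (algHom_ext (by simp))

@[simp] theorem comul_T :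
    Coalgebra.comul (R := k) (T k) = T k ⊗ₜ[k] 1 + 1 ⊗ₜ[k] T k :=
  lift_T k _

@[simp] theorem counit_T : Coalgebra.counit (R := k) (T k) = 0 :=
  lift_T k _

/-- The inverse on `𝔾_a`: the antipode is the algebra homomorphism `T ↦ -T`. -/
noncomputable instance : HopfAlgebra k (GaCoord k) where
  antipode := (lift k (-T k)).toLinearMap
  mul_antipode_rTensor_comul :=
    congrArg AlgHom.toLinearMap (algHom_ext (f := (Algebra.TensorProduct.lmul' k).comp
      ((Algebra.TensorProduct.map (lift k (-T k)) (AlgHom.id k (GaCoord k))).comp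
        (Bialgebra.comulAlgHom k (GaCoord k))))
      (g := (Algebra.ofId k (GaCoord k)).comp (Bialgebra.counitAlgHom k (GaCoord k))) (by simp))
  mul_antipode_lTensor_comul :=
    congrArg AlgHom.toLinearMap (algHom_ext (f := (Algebra.TensorProduct.lmul' k).comp
      ((Algebra.TensorProduct.map (AlgHom.id k (GaCoord k)) (lift k (-T k))).comp
        (Bialgebra.comulAlgHom k (GaCoord k))))
      (g := (Algebra.ofId k (GaCoord k)).comp (Bialgebra.counitAlgHom k (GaCoord k))) (by simp))

end GaCoord

/-! ### Comodules -/

/-- A right comodule structure `V → V ⊗ C` over a `k`-coalgebra `C` on a `k`-vector space `V`. -/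
class RightComodule (k C V : Type u) [Field k] [AddCommGroup C] [Module k C] [Coalgebra k C]
    [AddCommGroup V] [Module k V] where
  /-- The coaction. -/
  coact : V →ₗ[k] V ⊗[k] C
  coassoc : (TensorProduct.assoc k V C C).toLinearMap ∘ₗ coact.rTensor C ∘ₗ coact =
    (Coalgebra.comul (R := k) (A := C)).lTensor V ∘ₗ coact
  counit : (TensorProduct.rid k V).toLinearMap ∘ₗ
    (Coalgebra.counit (R := k) (A := C)).lTensor V ∘ₗ coact = LinearMap.id

namespace RightComodule

variable {k C V W : Type u} [Field k] [AddCommGroup C] [Module k C] [Coalgebra k C]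
  [AddCommGroup V] [Module k V] [RightComodule k C V] [AddCommGroup W] [Module k W]

/-- If `f : V → W` intertwines the coaction of `V` with `c`, then `c` is coassociative on the image
of `f`. -/
theorem coassoc_of_intertwines (c : W →ₗ[k] W ⊗[k] C) (f : V →ₗ[k] W)
    (h : c ∘ₗ f = f.rTensor C ∘ₗ coact) :
    ((TensorProduct.assoc k W C C).toLinearMap ∘ₗ c.rTensor C ∘ₗ c) ∘ₗ f =
      ((Coalgebra.comul (R := k) (A := C)).lTensor W ∘ₗ c) ∘ₗ f := by
  have h1 : (TensorProduct.assoc k W C C).toLinearMap ∘ₗ (f.rTensor C).rTensor C =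
      f.rTensor (C ⊗[k] C) ∘ₗ (TensorProduct.assoc k V C C).toLinearMap := by
    ext; simp
  have h2 : (Coalgebra.comul (R := k) (A := C)).lTensor W ∘ₗ f.rTensor C =
      f.rTensor (C ⊗[k] C) ∘ₗ (Coalgebra.comul (R := k) (A := C)).lTensor V := by
    ext; simp
  calc ((TensorProduct.assoc k W C C).toLinearMap ∘ₗ c.rTensor C ∘ₗ c) ∘ₗ f
      = (TensorProduct.assoc k W C C).toLinearMap ∘ₗ (c.rTensor C ∘ₗ f.rTensor C) ∘ₗ coact := by
        simp only [LinearMap.comp_assoc, h]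
    _ = ((TensorProduct.assoc k W C C).toLinearMap ∘ₗ (f.rTensor C).rTensor C) ∘ₗ
          coact.rTensor C ∘ₗ coact := by
        rw [← LinearMap.rTensor_comp, h, LinearMap.rTensor_comp]
        simp only [LinearMap.comp_assoc]
    _ = f.rTensor (C ⊗[k] C) ∘ₗ (Coalgebra.comul (R := k) (A := C)).lTensor V ∘ₗ coact := by
        rw [h1, LinearMap.comp_assoc, coassoc]
    _ = ((Coalgebra.comul (R := k) (A := C)).lTensor W ∘ₗ c) ∘ₗ f := by
        rw [LinearMap.comp_assoc, h, ← LinearMap.comp_assoc, ← h2, LinearMap.comp_assoc]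

/-- If `f : V → W` intertwines the coaction of `V` with `c`, then `c` is counital on the image
of `f`. -/
theorem counit_of_intertwines (c : W →ₗ[k] W ⊗[k] C) (f : V →ₗ[k] W)
    (h : c ∘ₗ f = f.rTensor C ∘ₗ coact) :
    ((TensorProduct.rid k W).toLinearMap ∘ₗ
      (Coalgebra.counit (R := k) (A := C)).lTensor W ∘ₗ c) ∘ₗ f = f := by
  have h1 : (TensorProduct.rid k W).toLinearMap ∘ₗ
      (Coalgebra.counit (R := k) (A := C)).lTensor W ∘ₗ f.rTensor C =
      f ∘ₗ (TensorProduct.rid k V).toLinearMap ∘ₗ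
        (Coalgebra.counit (R := k) (A := C)).lTensor V := by
    ext; simp
  calc ((TensorProduct.rid k W).toLinearMap ∘ₗ
      (Coalgebra.counit (R := k) (A := C)).lTensor W ∘ₗ c) ∘ₗ f
      = ((TensorProduct.rid k W).toLinearMap ∘ₗ
      (Coalgebra.counit (R := k) (A := C)).lTensor W ∘ₗ f.rTensor C) ∘ₗ coact := by
        simp only [LinearMap.comp_assoc, h]
    _ = f := by
        rw [h1]; simp only [LinearMap.comp_assoc, counit, LinearMap.comp_id]

end RightComodule

section Category

variable (k C : Type u) [Field k] [AddCommGroup C] [Module k C] [Coalgebra k C]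

/-- Finite dimensional right comodules over the coalgebra `C`. -/
structure FDComod : Type (u + 1) where
  /-- The underlying vector space. -/
  carrier : Type u
  [addCommGroup : AddCommGroup carrier]
  [module : Module k carrier]
  [finite : FiniteDimensional k carrier]
  [comodule : RightComodule k C carrier]

namespace FDComod

attribute [instance] addCommGroup module finite comodule

variable {k C}

/-- The coaction of a finite dimensional comodule. -/
def ρ (V : FDComod k C) : V.carrier →ₗ[k] V.carrier ⊗[k] C := RightComodule.coact

/-- Homomorphisms of comodules: linear maps that commute with the coactions. -/
@[ext] structure Hom (V W : FDComod k C) : Type u where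
  /-- The underlying linear map. -/
  lin : V.carrier →ₗ[k] W.carrier
  comm : W.ρ ∘ₗ lin = lin.rTensor C ∘ₗ V.ρ

noncomputable instance : Category (FDComod k C) where
  Hom := Hom
  id V := ⟨LinearMap.id, by simp⟩
  comp f g := ⟨g.lin ∘ₗ f.lin, by
    rw [← LinearMap.comp_assoc, g.comm, LinearMap.comp_assoc, f.comm, LinearMap.rTensor_comp,
      LinearMap.comp_assoc]⟩

@[ext] theorem hom_ext {V W : FDComod k C} {f g : V ⟶ W} (h : f.lin = g.lin) : f = g :=
  Hom.ext h

@[simp] theorem id_lin (V : FDComod k C) : Hom.lin (𝟙 V) = LinearMap.id := rfl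

@[simp] theorem comp_lin {U V W : FDComod k C} (f : U ⟶ V) (g : V ⟶ W) :
    (f ≫ g).lin = g.lin ∘ₗ f.lin := rfl

noncomputable instance (V W : FDComod k C) : Zero (V ⟶ W) := ⟨⟨0, by simp⟩⟩

noncomputable instance (V W : FDComod k C) : Add (V ⟶ W) :=
  ⟨fun f g => ⟨f.lin + g.lin, by
    simp only [LinearMap.comp_add, LinearMap.rTensor_add, LinearMap.add_comp, f.comm, g.comm]⟩⟩

noncomputable instance (V W : FDComod k C) : Neg (V ⟶ W) :=
  ⟨fun f => ⟨-f.lin, by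
    simp only [LinearMap.comp_neg, LinearMap.rTensor_neg, LinearMap.neg_comp, f.comm]⟩⟩

noncomputable instance (V W : FDComod k C) : AddCommGroup (V ⟶ W) where
  add_assoc _ _ _ := hom_ext (add_assoc _ _ _)
  zero_add _ := hom_ext (zero_add _)
  add_zero _ := hom_ext (add_zero _)
  add_comm _ _ := hom_ext (add_comm _ _)
  neg_add_cancel _ := hom_ext (neg_add_cancel _)
  nsmul := nsmulRec
  zsmul := zsmulRec

@[simp] theorem zero_lin (V W : FDComod k C) : Hom.lin (0 : V ⟶ W) = 0 := rfl

@[simp] theorem add_lin {V W : FDComod k C} (f g : V ⟶ W) : (f + g).lin = f.lin + g.lin := rfl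

noncomputable instance : Preadditive (FDComod k C) where
  add_comp _ _ _ _ _ _ := hom_ext (LinearMap.comp_add _ _ _)
  comp_add _ _ _ _ _ _ := hom_ext (LinearMap.add_comp _ _ _)

/-- The coaction `(v, w) ↦ (inl ⊗ 1) (ρ v) + (inr ⊗ 1) (ρ w)` on a direct sum. -/
noncomputable def sumCoact (V W : FDComod k C) :
    V.carrier × W.carrier →ₗ[k] (V.carrier × W.carrier) ⊗[k] C :=
  LinearMap.coprod ((LinearMap.inl k V.carrier W.carrier).rTensor C ∘ₗ V.ρ)
    ((LinearMap.inr k V.carrier W.carrier).rTensor C ∘ₗ W.ρ)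

/-- The direct sum of two finite dimensional comodules. -/
noncomputable def sum (V W : FDComod k C) : FDComod k C where
  carrier := V.carrier × W.carrier
  comodule :=
    { coact := sumCoact V W
      coassoc := LinearMap.prod_ext
        (RightComodule.coassoc_of_intertwines _ _ (LinearMap.coprod_inl _ _))
        (RightComodule.coassoc_of_intertwines _ _ (LinearMap.coprod_inr _ _))
      counit := LinearMap.prod_ext
        (RightComodule.counit_of_intertwines _ _ (LinearMap.coprod_inl _ _))
        (RightComodule.counit_of_intertwines _ _ (LinearMap.coprod_inr _ _)) }

theorem ρ_comp_fst (V W : FDComod k C) : V.ρ ∘ₗ LinearMap.fst k V.carrier W.carrier =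
    (LinearMap.fst k V.carrier W.carrier).rTensor C ∘ₗ sumCoact V W := by
  refine LinearMap.prod_ext ?_ ?_
  · rw [sumCoact, LinearMap.comp_assoc, LinearMap.comp_assoc, LinearMap.coprod_inl,
      ← LinearMap.comp_assoc, ← LinearMap.comp_assoc, ← LinearMap.rTensor_comp,
      LinearMap.comp_assoc, LinearMap.fst_comp_inl]
    simp
  · rw [sumCoact, LinearMap.comp_assoc, LinearMap.comp_assoc, LinearMap.coprod_inr,
      ← LinearMap.comp_assoc, ← LinearMap.comp_assoc, ← LinearMap.rTensor_comp,
      LinearMap.comp_assoc, LinearMap.fst_comp_inr]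
    simp

theorem ρ_comp_snd (V W : FDComod k C) : W.ρ ∘ₗ LinearMap.snd k V.carrier W.carrier =
    (LinearMap.snd k V.carrier W.carrier).rTensor C ∘ₗ sumCoact V W := by
  refine LinearMap.prod_ext ?_ ?_
  · rw [sumCoact, LinearMap.comp_assoc, LinearMap.comp_assoc, LinearMap.coprod_inl,
      ← LinearMap.comp_assoc, ← LinearMap.comp_assoc, ← LinearMap.rTensor_comp,
      LinearMap.comp_assoc, LinearMap.snd_comp_inl]
    simp
  · rw [sumCoact, LinearMap.comp_assoc, LinearMap.comp_assoc, LinearMap.coprod_inr,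
      ← LinearMap.comp_assoc, ← LinearMap.comp_assoc, ← LinearMap.rTensor_comp,
      LinearMap.comp_assoc, LinearMap.snd_comp_inr]
    simp

/-- The direct sum with its inclusions and projections. -/
noncomputable def sumBicone (V W : FDComod k C) : BinaryBicone V W where
  pt := sum V W
  inl := ⟨LinearMap.inl k _ _, LinearMap.coprod_inl _ _⟩
  inr := ⟨LinearMap.inr k _ _, LinearMap.coprod_inr _ _⟩
  fst := ⟨LinearMap.fst k _ _, ρ_comp_fst V W⟩
  snd := ⟨LinearMap.snd k _ _, ρ_comp_snd V W⟩

instance : HasBinaryBiproducts (FDComod k C) where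
  has_binary_biproduct V W := HasBinaryBiproduct.mk
    { bicone := sumBicone V W
      isBilimit := isBinaryBilimitOfTotal _ (hom_ext (LinearMap.ext fun x =>
        Prod.ext (add_zero x.1) (zero_add x.2))) }

end FDComod
end Category

/-! ### Finite dimensional modules over an algebra -/

section Modules

open scoped ModuleCat

variable (k A : Type u) [Field k] [Ring A] [Algebra k A]

/-- The category of finite dimensional (left) modules over the `k`-algebra `A`. -/
abbrev FDMod : Type (u + 1) :=
  ObjectProperty.FullSubcategory (fun M : ModuleCat.{u} A => FiniteDimensional k M)

namespace FDMod

variable {k A}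

/-- The direct sum of two finite dimensional modules, with its inclusions and projections. -/
noncomputable def sumBicone (M N : FDMod k A) : BinaryBicone M N where
  pt := ⟨ModuleCat.of A (M.obj × N.obj), by
    have : FiniteDimensional k M.obj := M.property
    have : FiniteDimensional k N.obj := N.property
    have h : FiniteDimensional k (M.obj × N.obj) := inferInstance
    exact h⟩
  inl := ObjectProperty.homMk (ModuleCat.ofHom (LinearMap.inl A M.obj N.obj))
  inr := ObjectProperty.homMk (ModuleCat.ofHom (LinearMap.inr A M.obj N.obj))
  fst := ObjectProperty.homMk (ModuleCat.ofHom (LinearMap.fst A M.obj N.obj))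
  snd := ObjectProperty.homMk (ModuleCat.ofHom (LinearMap.snd A M.obj N.obj))

instance : HasBinaryBiproducts (FDMod k A) where
  has_binary_biproduct M N := HasBinaryBiproduct.mk
    { bicone := sumBicone M N
      isBilimit := isBinaryBilimitOfTotal _ (ObjectProperty.hom_ext _ (ModuleCat.hom_ext
        (LinearMap.ext fun x => Prod.ext (add_zero x.1) (zero_add x.2)))) }

end FDMod
end Modules

/-! ### The functor given by a bimodule -/

section Tensor

variable (k R C : Type u) [Field k] [Ring R] [Algebra k R]
  [AddCommGroup C] [Module k C] [Coalgebra k C]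

/-- A `C`-comodule `M` with a right action of the `k`-algebra `R` by comodule endomorphisms
(a right `R`-module is a left module over the opposite ring), free of finite rank over `R`. -/
structure FreeBimodule where
  /-- The underlying vector space. -/
  carrier : Type u
  [addCommGroup : AddCommGroup carrier]
  [module : Module k carrier]
  [comodule : RightComodule k C carrier]
  [rightModule : Module Rᵐᵒᵖ carrier]
  [isScalarTower : IsScalarTower k Rᵐᵒᵖ carrier]
  [free : Module.Free Rᵐᵒᵖ carrier]
  [finite : Module.Finite Rᵐᵒᵖ carrier]
  coact_smul (r : Rᵐᵒᵖ) : (RightComodule.coact : carrier →ₗ[k] carrier ⊗[k] C) ∘ₗ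
    Algebra.lsmul k k carrier r =
      (Algebra.lsmul k k carrier r).rTensor C ∘ₗ RightComodule.coact

namespace FreeBimodule

attribute [instance] addCommGroup module comodule rightModule isScalarTower free finite

variable {k R C} (M : FreeBimodule k R C)

section Object

variable (N : Type u) [AddCommGroup N] [Module k N] [Module R N]

/-- The relations `m r ⊗ n = m ⊗ r n` that define `M ⊗_R N` as a quotient of `M ⊗_k N`. -/
def relations : Submodule k (M.carrier ⊗[k] N) :=
  Submodule.span k {z | ∃ (m : M.carrier) (r : R) (n : N),
    z = (MulOpposite.op r • m) ⊗ₜ[k] n - m ⊗ₜ[k] (r • n)}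

/-- The tensor product `M ⊗_R N` over the (noncommutative) ring `R`. -/
abbrev Tensor : Type u := (M.carrier ⊗[k] N) ⧸ M.relations N

/-- The map `m ↦ m ⊗ n`. -/
noncomputable def tmulRight (n : N) : M.carrier →ₗ[k] M.Tensor N :=
  (M.relations N).mkQ ∘ₗ (TensorProduct.mk k M.carrier N).flip n

theorem tmulRight_smul (m : M.carrier) (r : R) (n : N) :
    M.tmulRight N n (MulOpposite.op r • m) = M.tmulRight N (r • n) m :=
  (Submodule.Quotient.eq _).2 (Submodule.subset_span ⟨m, r, n, rfl⟩)

variable {N} in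
theorem tensor_hom_ext {W : Type u} [AddCommGroup W] [Module k W] {f g : M.Tensor N →ₗ[k] W}
    (h : ∀ n, f ∘ₗ M.tmulRight N n = g ∘ₗ M.tmulRight N n) : f = g :=
  Submodule.linearMap_qext _ (TensorProduct.ext' fun m n => LinearMap.congr_fun (h n) m)

/-- The map `m ⊗ n ↦ ∑ (mᵢ ⊗ n) ⊗ cᵢ`, where `∑ mᵢ ⊗ cᵢ` is the coaction on `m`. -/
noncomputable def preCoact : M.carrier ⊗[k] N →ₗ[k] M.Tensor N ⊗[k] C :=
  (M.relations N).mkQ.rTensor C ∘ₗ (TensorProduct.rightComm k M.carrier C N).toLinearMap ∘ₗ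
    (RightComodule.coact : M.carrier →ₗ[k] M.carrier ⊗[k] C).rTensor N

theorem preCoact_tmul (m : M.carrier) (n : N) :
    M.preCoact N (m ⊗ₜ n) = (M.tmulRight N n).rTensor C (RightComodule.coact m) := by
  have : (M.relations N).mkQ.rTensor C ∘ₗ (TensorProduct.rightComm k M.carrier C N).toLinearMap ∘ₗ
      (TensorProduct.mk k (M.carrier ⊗[k] C) N).flip n = (M.tmulRight N n).rTensor C := by
    ext; rfl
  exact LinearMap.congr_fun this _

theorem relations_le : M.relations N ≤ LinearMap.ker (M.preCoact N) := by
  refine Submodule.span_le.2 ?_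
  rintro _ ⟨m, r, n, rfl⟩
  have h := LinearMap.congr_fun (M.coact_smul (MulOpposite.op r)) m
  have h2 : (M.tmulRight N n) ∘ₗ Algebra.lsmul k k M.carrier (MulOpposite.op r) =
      M.tmulRight N (r • n) := LinearMap.ext fun m => M.tmulRight_smul N m r n
  simp only [LinearMap.comp_apply, Algebra.lsmul_coe] at h
  rw [SetLike.mem_coe, LinearMap.mem_ker, map_sub, preCoact_tmul, preCoact_tmul, h, ← h2,
    LinearMap.rTensor_comp, LinearMap.comp_apply, sub_self]

/-- The coaction on `M ⊗_R N` induced by that of `M`. -/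
noncomputable def tensorCoact : M.Tensor N →ₗ[k] M.Tensor N ⊗[k] C :=
  (M.relations N).liftQ (M.preCoact N) (M.relations_le N)

theorem tensorCoact_comp (n : N) : M.tensorCoact N ∘ₗ M.tmulRight N n =
    (M.tmulRight N n).rTensor C ∘ₗ RightComodule.coact :=
  LinearMap.ext fun m => M.preCoact_tmul N m n

noncomputable instance : RightComodule k C (M.Tensor N) where
  coact := M.tensorCoact N
  coassoc := M.tensor_hom_ext fun n =>
    RightComodule.coassoc_of_intertwines _ _ (M.tensorCoact_comp N n)
  counit := M.tensor_hom_ext fun n =>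
    RightComodule.counit_of_intertwines _ _ (M.tensorCoact_comp N n)

instance [FiniteDimensional k N] : FiniteDimensional k (M.Tensor N) := by
  obtain ⟨S, hS⟩ := Module.Finite.fg_top (R := Rᵐᵒᵖ) (M := M.carrier)
  let L (m : M.carrier) : N →ₗ[k] M.Tensor N :=
    (M.relations N).mkQ ∘ₗ TensorProduct.mk k M.carrier N m
  let P : Submodule k (M.Tensor N) := ⨆ m : S, LinearMap.range (L m)
  have hP : ∀ (m : M.carrier) (n : N), M.tmulRight N n m ∈ P := by
    intro m
    have hm : m ∈ Submodule.span Rᵐᵒᵖ (S : Set M.carrier) := hS ▸ Submodule.mem_top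
    induction hm using Submodule.span_induction with
    | mem x hx =>
      exact fun n => Submodule.mem_iSup_of_mem (⟨x, hx⟩ : S) ⟨n, rfl⟩
    | zero => intro n; rw [map_zero]; exact P.zero_mem
    | add x y _ _ hx hy => intro n; rw [map_add]; exact P.add_mem (hx n) (hy n)
    | smul r x _ hx =>
      intro n
      have h := M.tmulRight_smul N x r.unop n
      rw [MulOpposite.op_unop] at h
      rw [h]; exact hx _
  have hT : P = ⊤ := by
    refine Submodule.eq_top_iff'.2 fun q => ?_
    obtain ⟨z, rfl⟩ := (M.relations N).mkQ_surjective q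
    induction z using TensorProduct.induction_on with
    | zero => rw [map_zero]; exact P.zero_mem
    | tmul m n => exact hP m n
    | add x y hx hy => rw [map_add]; exact P.add_mem hx hy
  have : FiniteDimensional k P := inferInstance
  rw [hT] at this
  exact Module.Finite.equiv (Submodule.topEquiv (R := k) (M := M.Tensor N))

end Object

section Map

variable {N N' : Type u} [AddCommGroup N] [Module k N] [Module R N] [IsScalarTower k R N]
  [AddCommGroup N'] [Module k N'] [Module R N'] [IsScalarTower k R N']

/-- The map `m ⊗ n ↦ m ⊗ f n`. -/
noncomputable def tensorMap (f : N →ₗ[R] N') : M.Tensor N →ₗ[k] M.Tensor N' :=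
  (M.relations N).mapQ (M.relations N') ((f.restrictScalars k).lTensor M.carrier) (by
    refine Submodule.span_le.2 ?_
    rintro _ ⟨m, r, n, rfl⟩
    exact Submodule.subset_span ⟨m, r, f n, by simp⟩)

theorem tensorMap_comp_tmulRight (f : N →ₗ[R] N') (n : N) :
    M.tensorMap f ∘ₗ M.tmulRight N n = M.tmulRight N' (f n) := rfl

theorem tensorCoact_comp_tensorMap (f : N →ₗ[R] N') :
    M.tensorCoact N' ∘ₗ M.tensorMap f = (M.tensorMap f).rTensor C ∘ₗ M.tensorCoact N :=
  M.tensor_hom_ext fun n => by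
    rw [LinearMap.comp_assoc, LinearMap.comp_assoc, tensorMap_comp_tmulRight, tensorCoact_comp,
      tensorCoact_comp, ← LinearMap.comp_assoc, ← LinearMap.rTensor_comp,
      tensorMap_comp_tmulRight]

end Map

open scoped ModuleCat in
/-- The functor `N ↦ M ⊗_R N` from finite dimensional `R`-modules to finite dimensional
`C`-comodules. -/
noncomputable def tensorFunctor : FDMod k R ⥤ FDComod k C where
  obj N := haveI : FiniteDimensional k N.obj := N.property
    { carrier := M.Tensor N.obj }
  map f := ⟨M.tensorMap f.hom.hom, M.tensorCoact_comp_tensorMap f.hom.hom⟩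
  map_id _ := FDComod.hom_ext (M.tensor_hom_ext fun _ => rfl)
  map_comp _ _ := FDComod.hom_ext (M.tensor_hom_ext fun _ => rfl)

end FreeBimodule
end Tensor

/-! ### Wild representation type -/

/-- The category of finite dimensional right comodules over the `k`-coalgebra `C` is *wild* if there
is a `C`-comodule `M`, with a compatible right action of the free algebra `R = k⟨x, y⟩` for which `M`
is free of finite rank, such that the functor `N ↦ M ⊗_R N`, from finite dimensional
`k⟨x, y⟩`-modules to finite dimensional `C`-comodules, preserves indecomposability and reflects
isomorphism classes. (This functor is `k`-linear, and exact because `M` is free over `R`.) -/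
def HasWildComodules (k C : Type u) [Field k] [AddCommGroup C] [Module k C] [Coalgebra k C] : Prop :=
  ∃ M : FreeBimodule k (FreeAlgebra k (Fin 2)) C,
    (∀ N : FDMod k (FreeAlgebra k (Fin 2)),
      Indecomposable N → Indecomposable (M.tensorFunctor.obj N)) ∧
    (∀ N N' : FDMod k (FreeAlgebra k (Fin 2)),
      Nonempty (M.tensorFunctor.obj N ≅ M.tensorFunctor.obj N') → Nonempty (N ≅ N'))

/-! In characteristic `p` every power `T ^ p ^ i` is primitive, so operators whose pairwise products
all vanish, each attached to one such power, define a rational `𝔾_a`-module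
(`RightComodule.ofMulEqZero`). Representations of a Kronecker quiver with any finite number of
arrows are thus `𝔾_a`-modules, and three arrows suffice for wildness.

Take `M = R ⊕ R` with arrows from the first summand to the second given by left multiplication by
`1`, `x`, `y`, attached to `T`, `T ^ p`, `T ^ p ^ 2`. Then `M ⊗_R N` is `N ⊕ N` with arrows `1`,
`x`, `y`. A comodule homomorphism commutes with each arrow, because coefficient functionals recover
the arrows from the coaction. The arrow `1` forces its two diagonal blocks to be the same map `N →
N'`, and the arrows `x`, `y` make that map `R`-linear (`restrict`).

Passing to this block is additive and functorial, so isomorphisms descend. Composites of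
homomorphisms with zero block vanish (`comp_eq_zero_of_restrict_eq_zero`), so an idempotent is `0`
or `1` as soon as its block is, and indecomposability is preserved. -/

/-! ### Primitive elements of `k[T]` in characteristic `p`. -/

namespace GaCoord

variable (k : Type u) [Field k]

/-- The coefficient of `T ^ n`, as a linear functional on `k[T]`. -/
noncomputable def coeff (n : ℕ) : GaCoord k →ₗ[k] k := Polynomial.lcoeff k n

theorem coeff_T_pow (n m : ℕ) : coeff k n (T k ^ m) = if n = m then 1 else 0 :=
  Polynomial.coeff_X_pow m n

theorem coeff_one (n : ℕ) : coeff k n 1 = if n = 0 then 1 else 0 := by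
  rw [← coeff_T_pow k n 0, pow_zero]

instance : Nontrivial (GaCoord k) := inferInstanceAs (Nontrivial (Polynomial k))

/-- Comultiplication is an algebra homomorphism and the iterated Frobenius is additive on the tensor
square. -/
theorem comul_T_pow_char_pow (p : ℕ) [Fact p.Prime] [CharP k p] (i : ℕ) :
    Coalgebra.comul (R := k) (T k ^ p ^ i) =
      (T k ^ p ^ i) ⊗ₜ[k] 1 + 1 ⊗ₜ[k] (T k ^ p ^ i) := by
  have : CharP (GaCoord k ⊗[k] GaCoord k) p :=
    charP_of_injective_algebraMap (algebraMap k _).injective p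
  have h := map_pow (Bialgebra.comulAlgHom k (GaCoord k)) (T k) (p ^ i)
  simp only [Bialgebra.comulAlgHom_apply, comul_T] at h
  rw [h, add_pow_char_pow]
  simp [Algebra.TensorProduct.tmul_pow]

end GaCoord

/-! ### Comodules from operators with vanishing products. -/

namespace RightComodule

variable {k : Type u} [Field k] {V : Type u} [AddCommGroup V] [Module k V]

section Square

variable {ι : Type*} [Fintype ι]

/-- The linear map `v ↦ v ⊗ 1 + ∑ Xᵢ v ⊗ T ^ (p ^ i)`. -/
noncomputable def frobeniusCoact (p : ℕ) (d : ι → ℕ) (X : ι → V →ₗ[k] V) :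
    V →ₗ[k] V ⊗[k] GaCoord k :=
  (TensorProduct.mk k V (GaCoord k)).flip 1 +
    ∑ i, (TensorProduct.mk k V (GaCoord k)).flip (GaCoord.T k ^ p ^ d i) ∘ₗ X i

theorem frobeniusCoact_apply (p : ℕ) (d : ι → ℕ) (X : ι → V →ₗ[k] V) (v : V) :
    frobeniusCoact p d X v = v ⊗ₜ 1 + ∑ i, X i v ⊗ₜ[k] (GaCoord.T k ^ p ^ d i) := by
  simp [frobeniusCoact]

/-- Operators all of whose pairwise products vanish define a rational `𝔾_a`-module in
characteristic `p`. -/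
noncomputable abbrev ofMulEqZero (p : ℕ) [Fact p.Prime] [CharP k p] (d : ι → ℕ)
    (X : ι → V →ₗ[k] V) (hX : ∀ i j v, X i (X j v) = 0) : RightComodule k (GaCoord k) V where
  coact := frobeniusCoact p d X
  coassoc := by
    ext v
    -- The double coaction has cross terms in `X i (X j v)`, which vanish by `hX`; the rest matches
    -- because the powers of `T` are primitive.
    simp only [LinearMap.comp_apply, frobeniusCoact_apply, map_add, map_sum,
      LinearMap.rTensor_tmul, LinearMap.lTensor_tmul, GaCoord.comul_T_pow_char_pow, hX,
      TensorProduct.zero_tmul, Finset.sum_const_zero, add_zero, TensorProduct.add_tmul,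
      TensorProduct.sum_tmul, LinearEquiv.coe_coe, TensorProduct.assoc_tmul, Bialgebra.comul_one,
      Algebra.TensorProduct.one_def, TensorProduct.tmul_add, Finset.sum_add_distrib]
    abel
  counit := by
    ext v
    have h (i : ι) : p ^ d i ≠ 0 := pow_ne_zero _ (Fact.out : p.Prime).ne_zero
    simp [frobeniusCoact_apply, zero_pow (h _)]

end Square

/-! ### Linear functionals on a coalgebra acting on its comodules. -/

variable {C W : Type u} [AddCommGroup C] [Module k C] [AddCommGroup W] [Module k W]

/-- Contraction of the second tensor factor with a linear functional. -/
noncomputable def contract (V : Type u) [AddCommGroup V] [Module k V] (φ : C →ₗ[k] k) :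
    V ⊗[k] C →ₗ[k] V :=
  (TensorProduct.rid k V).toLinearMap ∘ₗ φ.lTensor V

@[simp] theorem contract_tmul (φ : C →ₗ[k] k) (v : V) (c : C) :
    contract V φ (v ⊗ₜ c) = φ c • v := by
  simp [contract]

theorem contract_rTensor (φ : C →ₗ[k] k) (f : V →ₗ[k] W) (z : V ⊗[k] C) :
    contract W φ (f.rTensor C z) = f (contract V φ z) := by
  have : contract W φ ∘ₗ f.rTensor C = f ∘ₗ contract V φ := by ext; simp
  exact LinearMap.congr_fun this z

/-- The action of a linear functional on a comodule. -/
noncomputable def act (φ : C →ₗ[k] k) (V : Type u) [AddCommGroup V] [Module k V]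
    [Coalgebra k C] [RightComodule k C V] : V →ₗ[k] V :=
  contract V φ ∘ₗ coact

/-- Contraction touches only the coalgebra factor. This is how comodule homomorphisms are seen to
respect the individual operators in a coaction. -/
theorem act_map [Coalgebra k C] [RightComodule k C V] [RightComodule k C W] (φ : C →ₗ[k] k) {f : V →ₗ[k] W}
    (hf : coact ∘ₗ f = f.rTensor C ∘ₗ coact) (v : V) : act φ W (f v) = f (act φ V v) := by
  rw [act, act, LinearMap.comp_apply, LinearMap.comp_apply, ← contract_rTensor]
  exact congrArg _ (LinearMap.congr_fun hf v)

end RightComodule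

/-! ### Idempotents and indecomposability -/

namespace FDMod

open scoped ModuleCat

variable {k A : Type u} [Field k] [Ring A] [Algebra k A]

/-- A submodule of a finite dimensional module. -/
def ofSubmodule (N : FDMod k A) (S : Submodule A N.obj) : FDMod k A :=
  ⟨ModuleCat.of A S, by
    have : FiniteDimensional k N.obj := N.property
    exact Module.Finite.of_injective (R := k) (S.subtype.restrictScalars k)
      S.subtype_injective⟩

theorem isZero_of_ofSubmodule {N : FDMod k A} {S : Submodule A N.obj}
    (h : IsZero (N.ofSubmodule S)) : S = ⊥ := by
  refine (Submodule.eq_bot_iff _).2 fun x hx => ?_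
  have h0 := congrArg (fun f => f.hom.hom (⟨x, hx⟩ : S)) (h.eq_of_src (𝟙 _) 0)
  exact congrArg Subtype.val h0

/-- An idempotent endomorphism of an indecomposable module is `0` or `1`. -/
theorem eq_zero_or_eq_id_of_idempotent {N : FDMod k A} (hN : Indecomposable N)
    (e : N.obj →ₗ[A] N.obj) (he : e ∘ₗ e = e) : e = 0 ∨ e = LinearMap.id := by
  have he' (x) : e (e x) = e x := LinearMap.congr_fun he x
  -- The module splits as the range of `e` plus its kernel, with projections `e` and `1 - e`; one
  -- summand must then vanish.
  let P := N.ofSubmodule (LinearMap.range e)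
  let Q := N.ofSubmodule (LinearMap.ker e)
  let i : P ⟶ N := ObjectProperty.homMk (ModuleCat.ofHom (LinearMap.range e).subtype)
  let j : Q ⟶ N := ObjectProperty.homMk (ModuleCat.ofHom (LinearMap.ker e).subtype)
  let a : N ⟶ P := ObjectProperty.homMk (ModuleCat.ofHom e.rangeRestrict)
  let b : N ⟶ Q := ObjectProperty.homMk (ModuleCat.ofHom
    ((LinearMap.id - e).codRestrict (LinearMap.ker e) fun x => by simp [he']))
  have hia : i ≫ a = 𝟙 _ := by
    refine ObjectProperty.hom_ext _ (ModuleCat.hom_ext (LinearMap.ext ?_))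
    rintro ⟨_, x, rfl⟩
    exact Subtype.ext (he' x)
  have hib : i ≫ b = 0 := by
    refine ObjectProperty.hom_ext _ (ModuleCat.hom_ext (LinearMap.ext ?_))
    rintro ⟨_, x, rfl⟩
    exact Subtype.ext (sub_eq_zero.2 (he' x).symm)
  have hja : j ≫ a = 0 := by
    refine ObjectProperty.hom_ext _ (ModuleCat.hom_ext (LinearMap.ext ?_))
    rintro ⟨x, hx⟩
    exact Subtype.ext hx
  have hjb : j ≫ b = 𝟙 _ := by
    refine ObjectProperty.hom_ext _ (ModuleCat.hom_ext (LinearMap.ext ?_))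
    rintro ⟨x, hx⟩
    exact Subtype.ext ((congrArg (x - ·) (LinearMap.mem_ker.1 hx)).trans (sub_zero x))
  have hab : a ≫ i + b ≫ j = 𝟙 _ :=
    ObjectProperty.hom_ext _ (ModuleCat.hom_ext (LinearMap.ext fun x => add_sub_cancel (e x) x))
  let F : N ≅ P ⊞ Q :=
    { hom := biprod.lift a b
      inv := biprod.desc i j
      hom_inv_id := by rw [biprod.lift_desc, hab]
      inv_hom_id := by
        apply biprod.hom_ext' <;> apply biprod.hom_ext <;> simp [hia, hib, hja, hjb] }
  rcases hN.2 P Q F with h | h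
  · exact Or.inl (LinearMap.range_eq_bot.1 (isZero_of_ofSubmodule h))
  · refine Or.inr (LinearMap.ext fun x => ?_)
    exact LinearMap.ker_eq_bot.1 (isZero_of_ofSubmodule h) (he' x)

end FDMod

/-! ### The bimodule of a generalised Kronecker quiver -/

namespace KroneckerBimodule

/-- A ring is free of rank one as a right module over itself. -/
def opEquiv (R : Type*) [Semiring R] : Rᵐᵒᵖ ≃ₗ[Rᵐᵒᵖ] R where
  __ := MulOpposite.opAddEquiv.symm
  map_smul' _ _ := rfl

variable {k : Type u} [Field k] {n : ℕ}

/-- The unit followed by the generators of the free algebra. -/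
noncomputable def gen (k : Type u) [Field k] {n : ℕ} : Option (Fin n) → FreeAlgebra k (Fin n) :=
  fun i => i.elim 1 (FreeAlgebra.ι k)

/-- The Frobenius twist on which each generator acts. -/
def twist : Option (Fin n) → ℕ := fun i => i.elim 0 fun j => j + 1

/-- Different arrows sit on different powers of `T`, so coefficient functionals can tell them apart.
-/
theorem twist_injective : Function.Injective (twist (n := n)) := by
  rintro (_ | i) (_ | j) h <;> simp_all [twist, Fin.ext_iff]

/-- The operator `(r, s) ↦ (0, g r)`. -/
noncomputable def op (i : Option (Fin n)) :
    FreeAlgebra k (Fin n) × FreeAlgebra k (Fin n) →ₗ[k]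
      FreeAlgebra k (Fin n) × FreeAlgebra k (Fin n) :=
  LinearMap.inr k _ _ ∘ₗ LinearMap.mulLeft k (gen k i) ∘ₗ LinearMap.fst k _ _

theorem op_apply (i : Option (Fin n)) (v : FreeAlgebra k (Fin n) × FreeAlgebra k (Fin n)) :
    op i v = (0, gen k i * v.1) := rfl

/-- Every arrow lands in the second summand, which every arrow kills. -/
theorem op_op (i j : Option (Fin n)) (v : FreeAlgebra k (Fin n) × FreeAlgebra k (Fin n)) :
    op i (op j v) = 0 := by
  simp [op_apply]

variable (k n) (p : ℕ) [Fact p.Prime] [CharP k p]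

/-- The bimodule `R ⊕ R` over `R = k⟨x₁, …, xₙ⟩`, on which `𝔾_a` acts through the operators
`(r, s) ↦ (0, r)` and `(r, s) ↦ (0, xᵢ r)`. -/
noncomputable def bimodule : FreeBimodule k (FreeAlgebra k (Fin n)) (GaCoord k) where
  carrier := FreeAlgebra k (Fin n) × FreeAlgebra k (Fin n)
  comodule := RightComodule.ofMulEqZero p twist op op_op
  free :=
    have := Module.Free.of_equiv (opEquiv (FreeAlgebra k (Fin n)))
    inferInstance
  finite :=
    have := Module.Finite.equiv (opEquiv (FreeAlgebra k (Fin n)))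
    inferInstance
  coact_smul r := by
    -- Arrows multiply on the left and `R` acts on the right, so they commute by associativity.
    have h (i : Option (Fin n)) (v : FreeAlgebra k (Fin n) × FreeAlgebra k (Fin n)) :
        op i (r • v) = r • op i v := by
      ext
      · simp [op_apply]
      · simp [op_apply, mul_assoc]
    refine LinearMap.ext fun v => ?_
    change RightComodule.frobeniusCoact p twist op (r • v) =
      (Algebra.lsmul k k _ r).rTensor _ (RightComodule.frobeniusCoact p twist op v)
    simp [RightComodule.frobeniusCoact_apply, h]

/-- The exponent `p ^ twist i` is positive, which removes the term `v ⊗ 1`, and differs from the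
exponents of the other arrows. -/
theorem act_bimodule (i : Option (Fin n)) (v : FreeAlgebra k (Fin n) × FreeAlgebra k (Fin n)) :
    RightComodule.act (GaCoord.coeff k (p ^ twist i)) (bimodule k n p).carrier v = op i v := by
  have h : p ^ twist i ≠ 0 := pow_ne_zero _ (Fact.out : p.Prime).ne_zero
  have h' (j : Option (Fin n)) : p ^ twist i = p ^ twist j ↔ i = j :=
    (Nat.pow_right_injective (Fact.out : p.Prime).two_le).eq_iff.trans twist_injective.eq_iff
  change RightComodule.contract _ _ (RightComodule.frobeniusCoact p twist op v) = _
  rw [RightComodule.frobeniusCoact_apply, map_add, map_sum, RightComodule.contract_tmul,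
    GaCoord.coeff_one, if_neg h, zero_smul, zero_add, Finset.sum_eq_single i]
  · rw [RightComodule.contract_tmul, GaCoord.coeff_T_pow, if_pos rfl, one_smul]
  · intro j _ hj
    rw [RightComodule.contract_tmul, GaCoord.coeff_T_pow, if_neg (mt (h' j).1 hj.symm), zero_smul]
  · simp

/-! ### The decomposition of `M ⊗_R N` as `N ⊕ N`. -/

section Tensor

variable (N : Type u) [AddCommGroup N] [Module k N] [Module (FreeAlgebra k (Fin n)) N]

/-- The map `b ↦ (1, 0) ⊗ b`. -/
noncomputable def left : N →ₗ[k] (bimodule k n p).Tensor N :=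
  ((bimodule k n p).relations N).mkQ ∘ₗ TensorProduct.mk k (bimodule k n p).carrier N
    ((1, 0) : FreeAlgebra k (Fin n) × FreeAlgebra k (Fin n))

/-- The map `b ↦ (0, 1) ⊗ b`. -/
noncomputable def right : N →ₗ[k] (bimodule k n p).Tensor N :=
  ((bimodule k n p).relations N).mkQ ∘ₗ TensorProduct.mk k (bimodule k n p).carrier N
    ((0, 1) : FreeAlgebra k (Fin n) × FreeAlgebra k (Fin n))

/-- Write `(r, s) = (1, 0) r + (0, 1) s` and move `r` and `s` across the tensor sign. -/
theorem tmulRight_eq (r s : FreeAlgebra k (Fin n)) (b : N) :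
    (bimodule k n p).tmulRight N b ((r, s) : FreeAlgebra k (Fin n) × FreeAlgebra k (Fin n)) =
      left k n p N (r • b) + right k n p N (s • b) := by
  have h1 := (bimodule k n p).tmulRight_smul N
    ((1, 0) : FreeAlgebra k (Fin n) × FreeAlgebra k (Fin n)) r b
  have h2 := (bimodule k n p).tmulRight_smul N
    ((0, 1) : FreeAlgebra k (Fin n) × FreeAlgebra k (Fin n)) s b
  refine Eq.trans ?_ (congrArg₂ (· + ·) h1 h2)
  rw [← map_add]
  refine congrArg _ ?_
  change (r, s) = ((1 * r, 0 * r) + (0 * s, 1 * s) :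
    FreeAlgebra k (Fin n) × FreeAlgebra k (Fin n))
  simp

/-- The map `m ↦ m ⊗ b` is a comodule homomorphism, so `act_map` transports the arrows from `M`. -/
theorem act_tmulRight (i : Option (Fin n)) (b : N)
    (v : FreeAlgebra k (Fin n) × FreeAlgebra k (Fin n)) :
    RightComodule.act (GaCoord.coeff k (p ^ twist i)) ((bimodule k n p).Tensor N)
      ((bimodule k n p).tmulRight N b v) = (bimodule k n p).tmulRight N b (op i v) :=
  (RightComodule.act_map (V := (bimodule k n p).carrier) (GaCoord.coeff k (p ^ twist i))
    ((bimodule k n p).tensorCoact_comp N b) v).trans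
    (congrArg _ (act_bimodule k n p i v))

theorem act_left (i : Option (Fin n)) (b : N) :
    RightComodule.act (GaCoord.coeff k (p ^ twist i)) ((bimodule k n p).Tensor N)
      (left k n p N b) = right k n p N (gen k i • b) := by
  refine (act_tmulRight k n p N i b (1, 0)).trans ?_
  rw [op_apply, tmulRight_eq]
  simp

theorem act_right (i : Option (Fin n)) (b : N) :
    RightComodule.act (GaCoord.coeff k (p ^ twist i)) ((bimodule k n p).Tensor N)
      (right k n p N b) = 0 := by
  refine (act_tmulRight k n p N i b (0, 1)).trans ?_
  rw [op_apply, tmulRight_eq]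
  simp

theorem tensor_hom_ext {W : Type u} [AddCommGroup W] [Module k W]
    {f g : (bimodule k n p).Tensor N →ₗ[k] W} (hl : f ∘ₗ left k n p N = g ∘ₗ left k n p N)
    (hr : f ∘ₗ right k n p N = g ∘ₗ right k n p N) : f = g := by
  refine (bimodule k n p).tensor_hom_ext fun b => LinearMap.ext fun v => ?_
  obtain ⟨r, s⟩ := v
  have h1 := LinearMap.congr_fun hl (r • b)
  have h2 := LinearMap.congr_fun hr (s • b)
  have h := tmulRight_eq k n p N r s b
  refine (congrArg f h).trans (Eq.trans ?_ (congrArg g h.symm))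
  rw [map_add, map_add]
  exact congrArg₂ (· + ·) h1 h2

variable [IsScalarTower k (FreeAlgebra k (Fin n)) N]

/-- The map `(r, s) ⊗ b ↦ (r b, s b)`. -/
noncomputable def toProd : (bimodule k n p).Tensor N →ₗ[k] N × N :=
  ((bimodule k n p).relations N).liftQ
    (TensorProduct.lift (LinearMap.mk₂ k
      (fun (v : FreeAlgebra k (Fin n) × FreeAlgebra k (Fin n)) (b : N) => (v.1 • b, v.2 • b))
      (fun _ _ _ => Prod.ext (add_smul _ _ _) (add_smul _ _ _))
      (fun _ _ _ => Prod.ext (smul_assoc _ _ _) (smul_assoc _ _ _))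
      (fun _ _ _ => Prod.ext (smul_add _ _ _) (smul_add _ _ _))
      (fun _ _ _ => Prod.ext (smul_comm _ _ _) (smul_comm _ _ _)))) (by
    refine Submodule.span_le.2 ?_
    rintro _ ⟨⟨r, s⟩, t, b, rfl⟩
    refine LinearMap.mem_ker.2 ((map_sub _ _ _).trans (sub_eq_zero.2 ?_))
    exact Prod.ext (mul_smul r t b) (mul_smul s t b))

theorem toProd_left (b : N) : toProd k n p N (left k n p N b) = (b, 0) :=
  Prod.ext (one_smul _ b) (zero_smul _ b)

theorem toProd_right (b : N) : toProd k n p N (right k n p N b) = (0, b) :=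
  Prod.ext (zero_smul _ b) (one_smul _ b)

/-- With `toProd_left` and `toProd_right`, this identifies the tensor product with `N × N`; it is
enough to check it on the two copies of `N`. -/
theorem left_add_right (z : (bimodule k n p).Tensor N) :
    left k n p N (toProd k n p N z).1 + right k n p N (toProd k n p N z).2 = z := by
  have : left k n p N ∘ₗ LinearMap.fst k N N ∘ₗ toProd k n p N +
      right k n p N ∘ₗ LinearMap.snd k N N ∘ₗ toProd k n p N = LinearMap.id := by
    apply tensor_hom_ext <;> ext b <;> simp [toProd_left, toProd_right]
  exact LinearMap.congr_fun this z

end Tensor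

/-! ### From comodule homomorphisms back to module homomorphisms. -/

section Hom

variable {k n}
variable {N N' N'' : FDMod k (FreeAlgebra k (Fin n))}

open scoped ModuleCat

/-- The linear map underlying `restrict`. -/
noncomputable def restrictLin
    (f : (bimodule k n p).tensorFunctor.obj N ⟶ (bimodule k n p).tensorFunctor.obj N') :
    N.obj →ₗ[k] N'.obj :=
  LinearMap.fst k _ _ ∘ₗ toProd k n p N'.obj ∘ₗ f.lin ∘ₗ left k n p N.obj

/-- Apply `f` to the `i`-th arrow at `left b`. Since `f` commutes with the arrow, and the arrow
kills the second component of `f (left b)`, only the first component, `restrictLin p f b`,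
contributes. -/
theorem lin_right_gen
    (f : (bimodule k n p).tensorFunctor.obj N ⟶ (bimodule k n p).tensorFunctor.obj N')
    (i : Option (Fin n)) (b : N.obj) :
    f.lin (right k n p N.obj (gen k i • b)) =
      right k n p N'.obj (gen k i • restrictLin p f b) := by
  have h := RightComodule.act_map (GaCoord.coeff k (p ^ twist i)) f.comm (left k n p N.obj b)
  have h1 := act_left k n p N.obj i b
  refine ((congrArg f.lin h1.symm).trans h.symm).trans ?_
  have h2 := left_add_right k n p N'.obj (f.lin (left k n p N.obj b))
  refine (congrArg _ h2.symm).trans ((map_add _ _ _).trans ?_)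
  refine (congrArg₂ (· + ·) (act_left k n p N'.obj i _) (act_right k n p N'.obj i _)).trans ?_
  exact add_zero _

/-- The arrow `1` is there for this: it makes the two diagonal blocks of `f` equal and the block
from the second summand to the first zero. -/
theorem lin_right
    (f : (bimodule k n p).tensorFunctor.obj N ⟶ (bimodule k n p).tensorFunctor.obj N')
    (b : N.obj) :
    f.lin (right k n p N.obj b) = right k n p N'.obj (restrictLin p f b) := by
  simpa [gen] using lin_right_gen p f none b

theorem right_injective (N : FDMod k (FreeAlgebra k (Fin n))) :
    Function.Injective (right k n p N.obj) := fun a b h => by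
  have h' := congrArg (fun z => (toProd k n p N.obj z).2) h
  simpa [toProd_right] using h'

/-- Both sides have the same image under the injection `right`: compare the arrow `1` at `xᵢ b` with
the arrow `xᵢ` at `b`. -/
theorem restrictLin_gen
    (f : (bimodule k n p).tensorFunctor.obj N ⟶ (bimodule k n p).tensorFunctor.obj N')
    (i : Fin n) (b : N.obj) :
    restrictLin p f (FreeAlgebra.ι k i • b) = FreeAlgebra.ι k i • restrictLin p f b :=
  right_injective p N' ((lin_right p f _).symm.trans (lin_right_gen p f (some i) b))

/-- A homomorphism `M ⊗ N → M ⊗ N'` restricts to a homomorphism `N → N'` on the second summand. -/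
noncomputable def restrict
    (f : (bimodule k n p).tensorFunctor.obj N ⟶ (bimodule k n p).tensorFunctor.obj N') :
    N.obj →ₗ[FreeAlgebra k (Fin n)] N'.obj where
  toFun := restrictLin p f
  map_add' := map_add _
  map_smul' r := by
    rw [RingHom.id_apply]
    induction r with
    | grade0 c => intro b; simp only [algebraMap_smul, map_smul]
    | grade1 i => exact restrictLin_gen p f i
    | mul r s hr hs => intro b; rw [mul_smul, hr, hs, mul_smul]
    | add r s hr hs => intro b; rw [add_smul, map_add, hr, hs, add_smul]

theorem restrict_right
    (f : (bimodule k n p).tensorFunctor.obj N ⟶ (bimodule k n p).tensorFunctor.obj N')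
    (b : N.obj) : f.lin (right k n p N.obj b) = right k n p N'.obj (restrict p f b) :=
  lin_right p f b

theorem restrict_comp
    (f : (bimodule k n p).tensorFunctor.obj N ⟶ (bimodule k n p).tensorFunctor.obj N')
    (g : (bimodule k n p).tensorFunctor.obj N' ⟶ (bimodule k n p).tensorFunctor.obj N'') :
    restrict p (f ≫ g) = restrict p g ∘ₗ restrict p f :=
  LinearMap.ext fun b => right_injective p N'' <| by
    refine (restrict_right p (f ≫ g) b).symm.trans ?_
    exact (congrArg g.lin (restrict_right p f b)).trans (restrict_right p g _)

theorem restrict_id (N : FDMod k (FreeAlgebra k (Fin n))) :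
    restrict p (𝟙 ((bimodule k n p).tensorFunctor.obj N)) = LinearMap.id :=
  LinearMap.ext fun b => right_injective p N (restrict_right p _ b).symm

theorem restrict_sub
    (f g : (bimodule k n p).tensorFunctor.obj N ⟶ (bimodule k n p).tensorFunctor.obj N') :
    restrict p (f - g) = restrict p f - restrict p g := by
  refine LinearMap.ext fun b => right_injective p N' ?_
  rw [LinearMap.sub_apply, map_sub, ← restrict_right, ← restrict_right, ← restrict_right,
    sub_eq_add_neg f g]
  exact (sub_eq_add_neg _ _).symm

/-- With zero diagonal blocks, `f` kills the second summand and sends the first into the second,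
which `g` kills. -/
theorem comp_eq_zero_of_restrict_eq_zero
    {f : (bimodule k n p).tensorFunctor.obj N ⟶ (bimodule k n p).tensorFunctor.obj N'}
    {g : (bimodule k n p).tensorFunctor.obj N' ⟶ (bimodule k n p).tensorFunctor.obj N''}
    (hf : restrict p f = 0) (hg : restrict p g = 0) : f ≫ g = 0 := by
  have hg' (b : N'.obj) : g.lin (right k n p N'.obj b) = 0 := by
    rw [restrict_right, hg]; exact map_zero _
  refine FDComod.hom_ext (tensor_hom_ext k n p N.obj ?_ ?_)
  · refine LinearMap.ext fun b => ?_
    have h2 := left_add_right k n p N'.obj (f.lin (left k n p N.obj b))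
    have h3 : (toProd k n p N'.obj (f.lin (left k n p N.obj b))).1 = 0 :=
      LinearMap.congr_fun hf b
    rw [h3, map_zero, zero_add] at h2
    exact (congrArg g.lin h2.symm).trans (hg' _)
  · refine LinearMap.ext fun b => ?_
    refine (congrArg g.lin (restrict_right p f b)).trans ?_
    rw [hg']; rfl

theorem indecomposable_tensor (hN : Indecomposable N) :
    Indecomposable ((bimodule k n p).tensorFunctor.obj N) := by
  constructor
  · refine fun h => hN.1 ((IsZero.iff_id_eq_zero _).2 ?_)
    have h1 := restrict_id p N
    -- On a zero object the identity equals `𝟙 - 𝟙`, whose restriction is zero by additivity.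
    rw [h.eq_of_src (𝟙 _) (𝟙 _ - 𝟙 _), restrict_sub, sub_self] at h1
    exact ObjectProperty.hom_ext _ (ModuleCat.hom_ext h1.symm)
  · intro Y Z F
    -- The idempotent projecting onto `Y`. If it restricts to `0`, then `e = e ≫ e = 0` and `Y`
    -- vanishes; if it restricts to `1`, the same argument for `𝟙 - e` makes `Z` vanish.
    let e := F.hom ≫ biprod.fst ≫ biprod.inl ≫ F.inv
    have he : e ≫ e = e := by simp [e]
    have h := restrict_comp p e e
    rw [he] at h
    rcases FDMod.eq_zero_or_eq_id_of_idempotent hN _ h.symm with h | h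
    · left
      have h0 : e = 0 := he.symm.trans (comp_eq_zero_of_restrict_eq_zero p h h)
      refine (IsZero.iff_id_eq_zero _).2 ?_
      have : 𝟙 Y = biprod.inl ≫ F.inv ≫ e ≫ F.hom ≫ biprod.fst := by simp [e]
      rw [this, h0]; simp
    · right
      have h1 : restrict p (𝟙 _ - e) = 0 := by rw [restrict_sub, restrict_id, h, sub_self]
      have h2 := comp_eq_zero_of_restrict_eq_zero p h1 h1
      have h0 : 𝟙 _ - e = 0 := by
        simpa [Preadditive.sub_comp, Preadditive.comp_sub, he] using h2
      refine (IsZero.iff_id_eq_zero _).2 ?_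
      have : 𝟙 Z = biprod.inr ≫ F.inv ≫ (𝟙 _ - e) ≫ F.hom ≫ biprod.snd := by
        simp [e, Preadditive.sub_comp]
      rw [this, h0]; simp

theorem nonempty_iso_of_tensor
    (F : (bimodule k n p).tensorFunctor.obj N ≅ (bimodule k n p).tensorFunctor.obj N') :
    Nonempty (N ≅ N') :=
  ⟨{ hom := ObjectProperty.homMk (ModuleCat.ofHom (restrict p F.hom))
     inv := ObjectProperty.homMk (ModuleCat.ofHom (restrict p F.inv))
     hom_inv_id := ObjectProperty.hom_ext _ (ModuleCat.hom_ext (by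
      refine (restrict_comp p F.hom F.inv).symm.trans ?_
      rw [F.hom_inv_id]; exact restrict_id p N))
     inv_hom_id := ObjectProperty.hom_ext _ (ModuleCat.hom_ext (by
      refine (restrict_comp p F.inv F.hom).symm.trans ?_
      rw [F.inv_hom_id]; exact restrict_id p N')) }⟩

end Hom

end KroneckerBimodule

/-- The category of finite dimensional rational `𝔾_a`-modules over an algebraically closed field of
characteristic `p > 0` is wild. -/
theorem mainTheorem12 (p : ℕ) [Fact p.Prime] (k : Type u) [Field k] [IsAlgClosed k] [CharP k p] :
    HasWildComodules k (GaCoord k) :=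
  ⟨KroneckerBimodule.bimodule k 2 p, fun _ => KroneckerBimodule.indecomposable_tensor p,
    fun _ _ ⟨F⟩ => KroneckerBimodule.nonempty_iso_of_tensor p F⟩
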